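/- All groups are finite and all characters are complex. For a group $G$ and a subgroup $K$, say that $(G,K)$ satisfies $(*)$ if there exist an element $g\in G\setminus \mathrm{Z}(G)$ and a nonlinear irreducible character $\chi$ of $G$ such that $\chi(g)\neq 0$, every nonlinear irreducible character $\psi\neq\chi$ of $G$ satisfies $\psi(g)=0$, and $K=\ker\chi=\{x\in G:\chi(x)=\chi(1)\}$. A group $X$ is a Frobenius group with Frobenius kernel $N$ if $N$ is a nontrivial normal subgroup of $X$ that has a nontrivial complement $H$ in $X$ such that no nontrivial element of $H$ commutes with a nontrivial element of $N$. Let $G$ be a finite group, $G'$ its commutator subgroup, $K$ a normal subgroup of $G$, and $p$ a prime. (a) Suppose that $(G,K)$ satisfies $(*)$, that $K\neq 1$ is a $p'$-group (that is, $p\nmid |K|$), that $G/K$ is a Frobenius group whose Frobenius kernel $G'/K$ is an elementary abelian $p$-group of order $p^m$ for an integer $m\geq 1$, and that $G/G'$ is cyclic of order $p^m-1$. Then $G$ is a $2$-Frobenius group: $G'$ is a Frobenius group with Frobenius kernel $K$, and $G/K$ is a Frobenius group with Frobenius kernel $G'/K$. Moreover, $m=1$. (b) Conversely, suppose that $K\leq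 G'$, that $G'$ is a Frobenius group with Frobenius kernel $K$, that $G/K$ is a Frobenius group with Frobenius kernel $G'/K$, that $|G':K|=p$, and that $G/G'$ is cyclic of order $p-1$. Then $(G,K)$ satisfies $(*)$. -/

import Mathlib

/-- `χ : G → ℂ` is the character of an irreducible finite-dimensional complex representation
of `G`. (Every finite-dimensional complex space is isomorphic to some `Fin n → ℂ`.) -/
def IsIrrChar {G : Type*} [Group G] (χ : G → ℂ) : Prop :=
  ∃ (n : ℕ) (ρ : Representation ℂ G (Fin n → ℂ)), ρ.IsIrreducible ∧ ρ.character = χ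

/-- `χ` is a nonlinear irreducible character: its degree `χ 1` is not `1`. -/
def IsNonlinearIrrChar {G : Type*} [Group G] (χ : G → ℂ) : Prop :=
  IsIrrChar χ ∧ χ 1 ≠ 1

/-- There are a noncentral element `g` and a nonlinear irreducible character `χ` with `χ g ≠ 0`
such that every other nonlinear irreducible character vanishes at `g`, and
`K` is the kernel `{x | χ x = χ 1}` of `χ`. -/
def IsolatedCharWithKernel (G : Type*) [Group G] (K : Subgroup G) : Prop :=
  ∃ (g : G) (χ : G → ℂ), g ∉ Subgroup.center G ∧ IsNonlinearIrrChar χ ∧ χ g ≠ 0 ∧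
    (∀ ψ : G → ℂ, IsNonlinearIrrChar ψ → ψ ≠ χ → ψ g = 0) ∧
    ∀ x : G, x ∈ K ↔ χ x = χ 1

/-- `G` is a Frobenius group with Frobenius kernel `N`: `G = N H` with `N` normal, `N ∩ H = 1`,
`N` and `H` nontrivial, and no nontrivial element of `H` centralizes a nontrivial element
of `N`. -/
def IsFrobeniusWithKernel {G : Type*} [Group G] (N : Subgroup G) : Prop :=
  N.Normal ∧ N ≠ ⊥ ∧ ∃ H : Subgroup G, H ≠ ⊥ ∧ N.IsComplement' H ∧
    ∀ h ∈ H, h ≠ 1 → ∀ n ∈ N, h * n = n * h → n = 1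

/-- `G` is a `2`-Frobenius group with respect to the normal subgroups `K ≤ L`: `L` is a Frobenius
group with kernel `K`, and `G / K` is a Frobenius group with kernel `L / K`. -/
def IsTwoFrobenius {G : Type*} [Group G] (K L : Subgroup G) [K.Normal] : Prop :=
  L.Normal ∧ K ≤ L ∧ IsFrobeniusWithKernel (K.subgroupOf L) ∧
    IsFrobeniusWithKernel (L.map (QuotientGroup.mk' K))

/-- `E` is an elementary abelian `p`-group. -/
def IsElementaryAbelian (p : ℕ) (E : Type*) [Group E] : Prop :=
  (∀ a b : E, a * b = b * a) ∧ ∀ a : E, a ^ p = 1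

/-! ### Orthogonality relations for irreducible characters. -/

section CharacterTheory

open scoped MonoidAlgebra

variable {G : Type*} [Group G]

/-! Column orthogonality turns isolation of a character into a statement about conjugacy classes. If
χ is the only nonlinear irreducible character with χ(g) ≠ 0, it reads |G:G'|·[gy⁻¹ ∈ G'] +
χ(g)χ(y⁻¹) = |C(y)|·[y ~ g]. Comparing y = 1 with general y shows that G' \ K is the class of g
(`isolated_mem_commutator_and_ker`, `IsolatedCharWithKernel.le_and_isConj_iff`).

(a) Counting then gives |C(x)| = p^m for every x in G' \ K. This is coprime to |K|, so x centralizes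
no nontrivial element of K. A complement of K in G' is therefore an elementary abelian p-group
acting fixed-point-freely on the p'-group K. Such a group is cyclic
(`mem_zpowers_of_fixedPointFree`), hence of order p, and m = 1.

(b) Take g ≠ 1 in a complement of K in G'. The two Frobenius conditions give |C(g)| ≤ p = |G:G'| +
1, and counting makes G' \ K the class of g. So g is conjugate to its nontrivial powers, its
character values are integers, and orthogonality of column g with itself leaves room for only one
nonlinear character nonzero at g (`exists_isolated_of_card_centralizer_le`). -/

theorem Representation.isIrreducible_of_forall_submodule {k V : Type*} [Field k] [AddCommGroup V]
    [Module k V] [Nontrivial V] (ρ : Representation k G V)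
    (h : ∀ W : Submodule k V, (∀ g, ∀ v ∈ W, ρ g v ∈ W) → W = ⊥ ∨ W = ⊤) :
    ρ.IsIrreducible := by
  have : Nontrivial (Subrepresentation ρ) := by
    refine ⟨⊥, ⊤, fun h0 => ?_⟩
    have h1 : (⊥ : Submodule k V) = ⊤ := congrArg Subrepresentation.toSubmodule h0
    exact bot_ne_top h1
  refine ⟨fun W => ?_⟩
  rcases h W.toSubmodule fun g v hv => W.apply_mem_toSubmodule g hv with h | h
  · exact Or.inl (Subrepresentation.toSubmodule_injective h)
  · exact Or.inr (Subrepresentation.toSubmodule_injective h)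

/-- The character afforded by a simple module over the group algebra is irreducible. -/
theorem isIrrChar_of_isSimpleModule (M : Type*) [AddCommGroup M] [Module ℂ M] [Module ℂ[G] M]
    [IsScalarTower ℂ ℂ[G] M] [FiniteDimensional ℂ M] [IsSimpleModule ℂ[G] M] :
    IsIrrChar (Representation.ofModule' (k := ℂ) (G := G) M).character := by
  let e := Module.finBasis ℂ M |>.equivFun
  let σ := Representation.ofModule' (k := ℂ) (G := G) M
  let ρ : Representation ℂ G (Fin (Module.finrank ℂ M) → ℂ) :=
    { toFun := fun g => e.conj (σ g)
      map_one' := by rw [map_one]; exact LinearEquiv.conj_id e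
      map_mul' := fun a b => by rw [map_mul]; exact LinearEquiv.conj_comp e _ _ }
  refine ⟨_, ρ, ?_, ?_⟩
  · have : Nontrivial M := IsSimpleModule.nontrivial ℂ[G] M
    have : Nontrivial (Fin (Module.finrank ℂ M) → ℂ) := e.symm.toEquiv.nontrivial
    refine Representation.isIrreducible_of_forall_submodule ρ fun W hW => ?_
    have hW' : ∀ (a : ℂ[G]) (x : M), e x ∈ W → e (a • x) ∈ W := by
      intro a x hx
      induction a using MonoidAlgebra.induction_on with
      | of g => simpa [ρ, σ, LinearEquiv.conj_apply, Representation.ofModule'] using hW g _ hx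
      | add a b ha hb => rw [add_smul, map_add]; exact W.add_mem ha hb
      | smul c a ha => rw [smul_assoc, map_smul]; exact W.smul_mem c ha
    let S : Submodule ℂ[G] M :=
      { carrier := {x | e x ∈ W}
        add_mem' := fun {a b} ha hb => by
          simp only [Set.mem_ofPred_eq, map_add]; exact W.add_mem ha hb
        zero_mem' := by simp
        smul_mem' := fun a x hx => hW' a x hx }
    rcases eq_bot_or_eq_top S with hS | hS
    · left
      refine (Submodule.eq_bot_iff W).2 fun w hw => ?_
      have : e.symm w ∈ S := by simpa [S] using hw
      rw [hS, Submodule.mem_bot] at this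
      simpa using this
    · right
      refine Submodule.eq_top_iff'.2 fun w => ?_
      have : e.symm w ∈ S := hS ▸ Submodule.mem_top
      simpa [S] using this
  · funext g
    exact LinearMap.trace_conj' _ _

/-- A class function orthogonal to every
irreducible character is zero. -/
theorem eq_zero_of_forall_isIrrChar_sum_eq_zero [Fintype G] (f : G → ℂ)
    (hf : ∀ x y, f (y * x * y⁻¹) = f x)
    (h : ∀ χ : G → ℂ, IsIrrChar χ → ∑ x, f x * χ x⁻¹ = 0) : f = 0 := by
  -- This element is central because `f` is a class function, so by Schur it acts on each simple
  -- left ideal as a scalar. The trace of that action is the vanishing sum, so the scalar is 0, and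
  -- semisimplicity gives `a = 0`.
  let a : ℂ[G] := ∑ x, MonoidAlgebra.single x⁻¹ (f x)
  have ha : ∀ b : ℂ[G], a * b = b * a := by
    intro b
    induction b using MonoidAlgebra.induction_on with
    | of g =>
      simp only [a, MonoidAlgebra.of_apply, Finset.sum_mul, Finset.mul_sum,
        MonoidAlgebra.single_mul_single, mul_one, one_mul]
      refine Fintype.sum_equiv (MulAut.conj g⁻¹).toEquiv _ _ fun x => ?_
      simp only [MulEquiv.toEquiv_eq_coe, MulEquiv.coe_toEquiv, MulAut.conj_apply]
      rw [hf x g⁻¹]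
      congr 1
      group
    | add b c hb hc => rw [mul_add, add_mul, hb, hc]
    | smul c b hb => rw [mul_smul_comm, smul_mul_assoc, hb]
  have key : ∀ S : Submodule ℂ[G] ℂ[G], IsSimpleModule ℂ[G] S → ∀ s ∈ S, a * s = 0 := by
    intro S hS
    let φ : Module.End ℂ[G] S :=
      { toFun := fun s => a • s
        map_add' := smul_add a
        map_smul' := fun b s => by
          simp only [RingHom.id_apply, smul_smul, ha b] }
    have : FiniteDimensional ℂ S :=
      inferInstanceAs (FiniteDimensional ℂ (S.restrictScalars ℂ))
    obtain ⟨c, hc⟩ := (IsSimpleModule.algebraMap_end_bijective_of_isAlgClosed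
      (A := ℂ[G]) (V := S) ℂ).2 φ
    have hc' : ∀ s : S, a • s = c • s := fun s => (LinearMap.congr_fun hc s).symm
    have hsum : ∑ x, f x • Representation.ofModule' (k := ℂ) (G := G) S x⁻¹ = c • LinearMap.id := by
      ext1 s
      simp only [LinearMap.sum_apply, LinearMap.smul_apply, LinearMap.id_apply]
      rw [← hc' s, Finset.sum_smul]
      refine Finset.sum_congr rfl fun x _ => ?_
      have hsingle : MonoidAlgebra.single x⁻¹ (f x) = f x • MonoidAlgebra.of ℂ G x⁻¹ := by simp
      rw [hsingle, smul_assoc]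
      simp [Representation.ofModule']
    have htr := congrArg (LinearMap.trace ℂ S) hsum
    rw [map_sum] at htr
    simp only [map_smul, smul_eq_mul] at htr
    have h0 := h _ (isIrrChar_of_isSimpleModule (G := G) S)
    simp only [Representation.character] at h0
    rw [h0, LinearMap.trace_id] at htr
    have : Nontrivial S := IsSimpleModule.nontrivial ℂ[G] S
    have hc0 : c = 0 := by
      have hfr : (Module.finrank ℂ S : ℂ) ≠ 0 := by
        exact_mod_cast Module.finrank_pos.ne'
      exact (mul_eq_zero.1 htr.symm).resolve_right hfr
    intro s hs
    have := hc' ⟨s, hs⟩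
    rw [hc0, zero_smul] at this
    exact congrArg Subtype.val this
  let T : Submodule ℂ[G] ℂ[G] :=
    { carrier := {s | a * s = 0}
      add_mem' := fun {x y} hx hy => by
        simp only [Set.mem_ofPred_eq] at *; rw [mul_add, hx, hy, add_zero]
      zero_mem' := mul_zero a
      smul_mem' := fun b s hs => by
        simp only [Set.mem_ofPred_eq, smul_eq_mul] at *
        rw [← mul_assoc, ha, mul_assoc, hs, mul_zero] }
  have : NeZero (Nat.card G : ℂ) := ⟨by exact_mod_cast Nat.card_pos.ne'⟩
  have hT : (⊤ : Submodule ℂ[G] ℂ[G]) ≤ T := by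
    rw [← IsSemisimpleModule.sSup_simples_eq_top]
    exact sSup_le fun S hS s hs => key S hS s hs
  have ha0 : a = 0 := by
    have : a * 1 = 0 := hT (Submodule.mem_top (x := (1 : ℂ[G])))
    rwa [mul_one] at this
  funext x
  classical
  have := congrArg (fun b : ℂ[G] => b.coeff x⁻¹) ha0
  simpa [a, Finsupp.single_apply, Finsupp.finsetSum_apply] using this

/-- Row orthogonality for irreducible characters. -/
theorem IsIrrChar.sum_mul_inv [Fintype G] {χ ψ : G → ℂ} (hχ : IsIrrChar χ) (hψ : IsIrrChar ψ)
    [Decidable (χ = ψ)] :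
    ∑ x, χ x * ψ x⁻¹ = if χ = ψ then (Nat.card G : ℂ) else 0 := by
  have hG : (Nat.card G : ℂ) ≠ 0 := by exact_mod_cast Nat.card_pos.ne'
  have := invertibleOfNonzero hG
  obtain ⟨n, ρ, hρ, rfl⟩ := hχ
  obtain ⟨m, σ, hσ, rfl⟩ := hψ
  have h1 := Representation.char_orthonormal ρ σ
  rw [inv_mul_eq_iff_eq_mul₀ hG] at h1
  rw [h1]
  by_cases he : Nonempty (Representation.Equiv σ ρ)
  · rw [if_pos he, mul_one, if_pos (Representation.char_iso he.some).symm]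
  · rw [if_neg he, mul_zero] at h1
    rw [if_neg he, mul_zero, if_neg]
    intro h2
    have h3 := Representation.char_orthonormal σ σ
    rw [inv_mul_eq_iff_eq_mul₀ hG, if_pos ⟨Representation.Equiv.refl σ⟩] at h3
    rw [h2] at h1
    rw [h1, mul_one] at h3
    exact hG h3.symm

/-- Row orthogonality makes the irreducible characters linearly independent in a finite-dimensional
space. -/
theorem finite_setOf_isIrrChar [Finite G] : {χ : G → ℂ | IsIrrChar χ}.Finite := by
  classical
  have := Fintype.ofFinite G
  have hli : LinearIndependent ℂ (fun χ : {χ : G → ℂ | IsIrrChar χ} => (χ : G → ℂ)) := by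
    rw [linearIndependent_iff']
    intro s c hc χ hχ
    have h1 : ∑ x, (∑ ψ ∈ s, c ψ • (ψ : G → ℂ)) x * (χ : G → ℂ) x⁻¹ = 0 := by
      rw [hc]; simp
    simp only [Finset.sum_apply, Pi.smul_apply, smul_eq_mul, Finset.sum_mul, mul_assoc] at h1
    rw [Finset.sum_comm] at h1
    simp only [← Finset.mul_sum] at h1
    rw [Finset.sum_congr rfl fun ψ _ => by rw [IsIrrChar.sum_mul_inv ψ.2 χ.2]] at h1
    simp only [← Subtype.ext_iff, mul_ite, mul_zero, Finset.sum_ite_eq', hχ, if_true] at h1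
    exact (mul_eq_zero.1 h1).resolve_right (by exact_mod_cast Nat.card_pos.ne')
  exact hli.setFinite

/-- The finite set of irreducible characters. -/
noncomputable def irrChars (G : Type*) [Group G] [Finite G] : Finset (G → ℂ) :=
  (finite_setOf_isIrrChar (G := G)).toFinset

@[simp]
theorem mem_irrChars [Finite G] {χ : G → ℂ} : χ ∈ irrChars G ↔ IsIrrChar χ := by
  simp [irrChars]

theorem IsIrrChar.conj {χ : G → ℂ} (hχ : IsIrrChar χ) (x y : G) : χ (y * x * y⁻¹) = χ x := by
  obtain ⟨n, ρ, -, rfl⟩ := hχ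
  exact ρ.char_conj x y

theorem IsIrrChar.eq_of_isConj {χ : G → ℂ} (hχ : IsIrrChar χ) {x y : G} (h : IsConj x y) :
    χ x = χ y := by
  obtain ⟨c, rfl⟩ := isConj_iff.1 h
  rw [hχ.conj]

open Classical in
/-- Column orthogonality for irreducible characters, before dividing by the class size. -/
theorem card_conj_mul_sum_irrChars [Finite G] (x y : G) :
    (Nat.card {z // IsConj y z} : ℂ) * ∑ χ ∈ irrChars G, χ x * χ y⁻¹ =
      if IsConj y x then (Nat.card G : ℂ) else 0 := by
  let _ := Fintype.ofFinite G
  have hG : (Nat.card G : ℂ) ≠ 0 := by exact_mod_cast Nat.card_pos.ne'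
  set c : ℂ := (Nat.card {z // IsConj y z} : ℂ)
  have hcl : ∀ χ, IsIrrChar χ →
      ∑ z, (if IsConj y z then (Nat.card G : ℂ) else 0) * χ z⁻¹ = Nat.card G * (c * χ y⁻¹) := by
    intro χ hχ
    have : ∀ z, (if IsConj y z then (Nat.card G : ℂ) else 0) * χ z⁻¹ =
        if IsConj y z then (Nat.card G : ℂ) * χ y⁻¹ else 0 := by
      intro z
      split_ifs with hz
      · obtain ⟨d, rfl⟩ := isConj_iff.1 hz
        rw [show (d * y * d⁻¹)⁻¹ = d * y⁻¹ * d⁻¹ by group, hχ.conj]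
      · rw [zero_mul]
    rw [Finset.sum_congr rfl fun z _ => this z, ← Finset.sum_filter, Finset.sum_const,
      nsmul_eq_mul, show c = ((Finset.univ.filter fun z => IsConj y z).card : ℂ) by
        simp only [c, Nat.card_eq_fintype_card, Fintype.card_subtype]]
    ring
  -- Both sides are class functions of `x`; by row orthogonality their difference is orthogonal to
  -- every irreducible character.
  have h0 := eq_zero_of_forall_isIrrChar_sum_eq_zero
    (fun z => (if IsConj y z then (Nat.card G : ℂ) else 0) -
      c * ∑ χ ∈ irrChars G, χ z * χ y⁻¹) ?_ ?_
  · convert (sub_eq_zero.1 (congrFun h0 x)).symm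
  · intro z w
    have h1 : IsConj y (w * z * w⁻¹) ↔ IsConj y z := by
      have : IsConj z (w * z * w⁻¹) := isConj_iff.2 ⟨w, rfl⟩
      exact ⟨fun h => h.trans this.symm, fun h => h.trans this⟩
    simp only [h1]
    congr 2
    exact Finset.sum_congr rfl fun χ hχ => by rw [(mem_irrChars.1 hχ).conj]
  · intro ψ hψ
    simp only [sub_mul, Finset.sum_sub_distrib, hcl ψ hψ, Finset.mul_sum, Finset.sum_mul]
    rw [Finset.sum_comm, sub_eq_zero]
    have : ∀ χ ∈ irrChars G, ∑ z, c * (χ z * χ y⁻¹) * ψ z⁻¹ =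
        if χ = ψ then Nat.card G * (c * χ y⁻¹) else 0 := by
      intro χ hχ
      have h2 := (mem_irrChars.1 hχ).sum_mul_inv hψ
      calc _ = c * χ y⁻¹ * ∑ z, χ z * ψ z⁻¹ := by
            rw [Finset.mul_sum]; exact Finset.sum_congr rfl fun z _ => by ring
        _ = _ := by rw [h2]; split_ifs <;> ring
    rw [Finset.sum_congr rfl this]
    simp [hψ]

theorem card_conj_mul_card_centralizer [Finite G] (y : G) :
    Nat.card {z // IsConj y z} * Nat.card (Subgroup.centralizer {y}) = Nat.card G := by
  rw [Subgroup.nat_card_centralizer_nat_card_stabilizer,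
    ← Nat.card_congr (ConjAct.toConjAct (G := G)).symm.toEquiv,
    ← Nat.card_congr (MulAction.orbitProdStabilizerEquivGroup (ConjAct G) y), Nat.card_prod]
  congr 1
  refine Nat.card_congr (Equiv.subtypeEquivRight fun z => ?_)
  rw [ConjAct.mem_orbit_conjAct, isConj_comm]

open Classical in
/-- Column orthogonality for irreducible characters. -/
theorem sum_irrChars_mul_inv [Finite G] (x y : G) :
    ∑ χ ∈ irrChars G, χ x * χ y⁻¹ =
      if IsConj y x then (Nat.card (Subgroup.centralizer {y}) : ℂ) else 0 := by
  have h1 := card_conj_mul_sum_irrChars x y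
  have h2 := card_conj_mul_card_centralizer y
  have hpos : (Nat.card {z // IsConj y z} : ℂ) ≠ 0 := by
    have : Nonempty {z // IsConj y z} := ⟨⟨y, IsConj.refl y⟩⟩
    exact_mod_cast Nat.card_pos.ne'
  apply mul_left_cancel₀ hpos
  rw [h1]
  split_ifs
  · rw [← h2]; push_cast; rfl
  · rw [mul_zero]

end CharacterTheory

/-! ### Linear characters, and characters isolated at an element. -/

section LinearCharacters

variable {G : Type*} [Group G]

/-- Operators on a line are scalars, so in degree 1 the trace itself is multiplicative. -/
theorem isIrrChar_and_apply_one_eq_one_iff {χ : G → ℂ} :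
    IsIrrChar χ ∧ χ 1 = 1 ↔ ∃ φ : G →* ℂˣ, χ = fun g => (φ g : ℂ) := by
  constructor
  · rintro ⟨⟨n, ρ, hρ, rfl⟩, h1⟩
    have hfr : Module.finrank ℂ (Fin n → ℂ) = 1 := by
      rw [Representation.char_one] at h1
      exact_mod_cast h1
    have hs : ∀ g, ρ g = ρ.character g • LinearMap.id := by
      intro g
      obtain ⟨c, hc, -⟩ := LinearMap.existsUnique_eq_smul_id_of_finrank_eq_one hfr (ρ g)
      have : ρ.character g = c := by
        rw [Representation.character, hc, map_smul, LinearMap.trace_id, hfr]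
        simp
      rw [this]; exact hc
    let φ : G →* ℂ :=
      { toFun := ρ.character
        map_one' := h1
        map_mul' := fun x y => by
          rw [Representation.character, map_mul, hs x, hs y]
          change LinearMap.trace ℂ _ ((ρ.character x • LinearMap.id) ∘ₗ (ρ.character y • LinearMap.id))
            = _
          rw [LinearMap.smul_comp, LinearMap.comp_smul, LinearMap.id_comp, map_smul, map_smul,
            LinearMap.trace_id, hfr]
          simp }
    exact ⟨φ.toHomUnits, rfl⟩
  · rintro ⟨φ, rfl⟩
    refine ⟨?_, by simp⟩
    let ρ : Representation ℂ G (Fin 1 → ℂ) :=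
      { toFun := fun g => (φ g : ℂ) • LinearMap.id
        map_one' := by ext; simp
        map_mul' := fun x y => by ext; simp; ring }
    refine ⟨1, ρ, ?_, ?_⟩
    · have := is_simple_module_of_finrank_eq_one (A := ℂ) (K := ℂ) (V := Fin 1 → ℂ) (by simp)
      exact Representation.isIrreducible_of_forall_submodule ρ fun W _ => eq_bot_or_eq_top W
    · funext g
      change LinearMap.trace ℂ (Fin 1 → ℂ) ((φ g : ℂ) • LinearMap.id) = _
      rw [map_smul, LinearMap.trace_id]
      simp

-- Evaluation at `x` is a character of the dual of G/G'. It is trivial exactly when `x` lies in G',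
-- because the dual separates points.
open Classical in
theorem sum_abelianization_hom [Finite G] [Fintype (Abelianization G →* ℂˣ)] (x : G) :
    ∑ φ : Abelianization G →* ℂˣ, (φ (Abelianization.of x) : ℂ) =
      if x ∈ commutator G then (Nat.card (G ⧸ commutator G) : ℂ) else 0 := by
  let ev : (Abelianization G →* ℂˣ) →* ℂ :=
    (Units.coeHom ℂ).comp (MonoidHom.eval (Abelianization.of x))
  have hev : ∀ φ, ev φ = (φ (Abelianization.of x) : ℂ) := fun φ => rfl
  have hfin : Finite (Abelianization G) := inferInstanceAs (Finite (G ⧸ commutator G))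
  have h := sum_hom_units ev
  simp only [hev] at h
  rw [h]
  have hiff : ev = 1 ↔ x ∈ commutator G := by
    rw [← Abelianization.ker_of, MonoidHom.mem_ker]
    constructor
    · intro h1
      by_contra hx
      obtain ⟨φ, hφ⟩ := CommGroup.exists_apply_ne_one_of_hasEnoughRootsOfUnity
        (Abelianization G) ℂ hx
      exact hφ (Units.ext (DFunLike.congr_fun h1 φ))
    · intro hx
      ext φ
      rw [hev, hx]; simp
  have hcard : Fintype.card (Abelianization G →* ℂˣ) = Nat.card (G ⧸ commutator G) := by
    rw [← Nat.card_eq_fintype_card]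
    exact CommGroup.card_monoidHom_of_hasEnoughRootsOfUnity (Abelianization G) ℂ
  simp only [hiff, hcard]
  split_ifs <;> simp

open Classical in
/-- The linear characters satisfy column orthogonality for the abelianization. -/
theorem sum_linear_irrChars [Finite G] (x y : G) :
    ∑ χ ∈ irrChars G with χ 1 = 1, χ x * χ y⁻¹ =
      if x * y⁻¹ ∈ commutator G then (Nat.card (G ⧸ commutator G) : ℂ) else 0 := by
  have : Finite (Abelianization G) := inferInstanceAs (Finite (G ⧸ commutator G))
  let _ := Fintype.ofFinite (Abelianization G →* ℂˣ)
  rw [← sum_abelianization_hom (x * y⁻¹)]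
  symm
  refine Finset.sum_bij (fun φ _ => fun g => (φ (Abelianization.of g) : ℂ)) ?_ ?_ ?_ ?_
  · intro φ _
    rw [Finset.mem_filter, mem_irrChars]
    exact isIrrChar_and_apply_one_eq_one_iff.2 ⟨φ.comp Abelianization.of, rfl⟩
  · intro φ _ ψ _ h
    apply Abelianization.hom_ext
    ext g
    exact congrFun h g
  · intro χ hχ
    rw [Finset.mem_filter, mem_irrChars] at hχ
    obtain ⟨φ, rfl⟩ := isIrrChar_and_apply_one_eq_one_iff.1 hχ
    exact ⟨Abelianization.lift φ, Finset.mem_univ _, by simp⟩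
  · intro φ _
    simp

open Classical in
/-- Column orthogonality with the linear characters summed up. -/
theorem card_add_sum_nonlinear_irrChars [Finite G] (x y : G) :
    (if x * y⁻¹ ∈ commutator G then (Nat.card (G ⧸ commutator G) : ℂ) else 0) +
      ∑ χ ∈ irrChars G with χ 1 ≠ 1, χ x * χ y⁻¹ =
      if IsConj y x then (Nat.card (Subgroup.centralizer {y}) : ℂ) else 0 := by
  rw [← sum_linear_irrChars, ← sum_irrChars_mul_inv]
  exact Finset.sum_filter_add_sum_filter_not _ _ _

theorem mem_filter_nonlinear_irrChars [Finite G] {χ : G → ℂ} [DecidablePred fun χ : G → ℂ => χ 1 ≠ 1] :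
    χ ∈ (irrChars G).filter (fun χ => χ 1 ≠ 1) ↔ IsNonlinearIrrChar χ := by
  rw [Finset.mem_filter, mem_irrChars]; rfl

open Classical in
/-- If `χ` is the only nonlinear irreducible character not vanishing at `g`, the sum over
nonlinear characters in column orthogonality has a single term. -/
theorem card_add_mul_of_isolated [Finite G] {g : G} {χ : G → ℂ} (hχ : IsNonlinearIrrChar χ)
    (hiso : ∀ ψ : G → ℂ, IsNonlinearIrrChar ψ → ψ ≠ χ → ψ g = 0) (y : G) :
    (if g * y⁻¹ ∈ commutator G then (Nat.card (G ⧸ commutator G) : ℂ) else 0) + χ g * χ y⁻¹ =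
      if IsConj y g then (Nat.card (Subgroup.centralizer {y}) : ℂ) else 0 := by
  rw [← card_add_sum_nonlinear_irrChars]
  rw [Finset.sum_eq_single_of_mem χ (mem_filter_nonlinear_irrChars.2 hχ)]
  intro ψ hψ hne
  rw [hiso ψ (mem_filter_nonlinear_irrChars.1 hψ) hne, zero_mul]

/-- If `χ` is the only nonlinear irreducible character not vanishing at `g`, then `g` lies in the
commutator subgroup and `ker χ` is the complement of the class of `g` in it. -/
theorem isolated_mem_commutator_and_ker [Finite G] {g : G} {χ : G → ℂ} (hg : g ≠ 1)
    (hχ : IsNonlinearIrrChar χ) (h0 : χ g ≠ 0)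
    (hiso : ∀ ψ : G → ℂ, IsNonlinearIrrChar ψ → ψ ≠ χ → ψ g = 0) :
    g ∈ commutator G ∧ ∀ x, χ x = χ 1 ↔ x ∈ commutator G ∧ ¬ IsConj x⁻¹ g := by
  have key := card_add_mul_of_isolated hχ hiso
  have hcard : (Nat.card (G ⧸ commutator G) : ℂ) ≠ 0 := by exact_mod_cast Nat.card_pos.ne'
  have hχ1 : χ 1 ≠ 0 := by
    obtain ⟨⟨n, ρ, hρ, rfl⟩, -⟩ := hχ
    have : Nontrivial (Fin n → ℂ) := by
      by_contra hn
      rw [not_nontrivial_iff_subsingleton] at hn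
      exact bot_ne_top (α := Subrepresentation ρ)
        (Subrepresentation.toSubmodule_injective (Subsingleton.elim _ _))
    rw [Representation.char_one]
    exact_mod_cast Module.finrank_pos.ne'
  have h1 := key 1
  rw [if_neg (show ¬ IsConj 1 g by rw [isConj_one_right]; exact hg), inv_one, mul_one] at h1
  have hgc : g ∈ commutator G := by
    by_contra hgc
    rw [if_neg hgc, zero_add] at h1
    exact mul_ne_zero h0 hχ1 h1
  rw [if_pos hgc] at h1
  refine ⟨hgc, fun x => ?_⟩
  -- For `x` in G', comparison with the relation at 1 gives χ(x) = χ(1) exactly when the centralizer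
  -- term is absent. For other `x` the relation forces χ(x) = 0.
  have hx := key x⁻¹
  rw [inv_inv] at hx
  by_cases hxc : x ∈ commutator G
  · rw [if_pos (mul_mem hgc hxc)] at hx
    by_cases hconj : IsConj x⁻¹ g
    · rw [if_pos hconj] at hx
      simp only [hconj, not_true, and_false, iff_false]
      intro h
      rw [h, h1] at hx
      exact (Nat.cast_ne_zero.2 Nat.card_pos.ne') hx.symm
    · rw [if_neg hconj, ← h1] at hx
      simp only [hxc, hconj, not_false_iff, and_self, iff_true]
      exact mul_left_cancel₀ h0 (add_left_cancel hx)
  · have hgx : g * x ∉ commutator G := fun h => hxc ((Subgroup.mul_mem_cancel_left _ hgc).1 h)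
    have hnc : ¬ IsConj x⁻¹ g := by
      intro hc
      obtain ⟨c, hc⟩ := isConj_iff.1 hc.symm
      apply hxc
      rw [← inv_mem_iff (x := x), ← hc]
      exact (inferInstance : (commutator G).Normal).conj_mem g hgc c
    rw [if_neg hgx, if_neg hnc, zero_add] at hx
    simp only [hxc, false_and, iff_false]
    intro h
    rw [h] at hx
    exact mul_ne_zero h0 hχ1 hx

/-- The trace is a sum of eigenvalues, each a |G|-th root of unity. -/
theorem IsIrrChar.isIntegral [Finite G] {χ : G → ℂ} (hχ : IsIrrChar χ) (g : G) :
    IsIntegral ℤ (χ g) := by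
  obtain ⟨n, ρ, -, rfl⟩ := hχ
  rw [Representation.character,
    Module.End.trace_eq_sum_roots_charpoly_of_splits (IsAlgClosed.splits _)]
  refine IsIntegral.multiset_sum fun μ hμ => ?_
  have hμ' : Module.End.HasEigenvalue (ρ g) μ := by
    rw [Module.End.hasEigenvalue_iff_isRoot_charpoly]
    exact Polynomial.isRoot_of_mem_roots hμ
  obtain ⟨v, hv⟩ := hμ'.exists_hasEigenvector
  have hpow := hv.pow_apply (Nat.card G)
  rw [← map_pow, pow_card_eq_one', map_one] at hpow
  have h1 : (μ ^ Nat.card G - 1) • v = 0 := by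
    rw [sub_smul, one_smul, ← hpow]; simp
  have h2 : μ ^ Nat.card G = 1 := sub_eq_zero.1 ((smul_eq_zero.1 h1).resolve_right hv.2)
  exact IsIntegral.of_pow Nat.card_pos (h2 ▸ isIntegral_one)

/-- Irreducible characters are integral at an element conjugate to all nontrivial elements of the
cyclic group it generates. -/
theorem IsIrrChar.exists_int_eq [Finite G] {χ : G → ℂ} (hχ : IsIrrChar χ) {g : G} (hg : g ≠ 1)
    (hconj : ∀ z ∈ Subgroup.zpowers g, z ≠ 1 → IsConj g z) : ∃ a : ℤ, χ g = a := by
  classical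
  have hint := hχ.isIntegral g
  have hχ' := hχ
  obtain ⟨n, ρ, -, hρ⟩ := hχ'
  let Z := Subgroup.zpowers g
  let _ := Fintype.ofFinite Z
  have hZ : (Nat.card Z : ℂ) ≠ 0 := by exact_mod_cast Nat.card_pos.ne'
  have := invertibleOfNonzero hZ
  -- Summing over Z = ⟨g⟩ gives χ(1) + (|Z| - 1)χ(g) = |Z|d, with d the dimension of the
  -- Z-invariants. So χ(g) is rational as well as an algebraic integer.
  have h1 := Representation.card_inv_mul_sum_char_eq_finrank (ρ.comp Z.subtype)
  rw [inv_mul_eq_iff_eq_mul₀ hZ] at h1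
  have h2 : ∀ z : Z, (Representation.character (ρ.comp Z.subtype)) z = χ z := by
    intro z; rw [← hρ]; rfl
  rw [Finset.sum_congr rfl fun z _ => h2 z, ← Finset.add_sum_erase _ _ (Finset.mem_univ (1 : Z)),
    Finset.sum_congr rfl (g := fun _ => χ g) (fun z hz => ?_), Finset.sum_const,
    Finset.card_erase_of_mem (Finset.mem_univ _), Finset.card_univ, ← Nat.card_eq_fintype_card,
    nsmul_eq_mul] at h1
  · have h3 : χ 1 = (n : ℂ) := by rw [← hρ, Representation.char_one]; simp
    have hZ2 : 1 < Nat.card Z := by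
      rw [Nat.card_zpowers]
      have := orderOf_eq_one_iff.not.2 hg
      have := orderOf_pos g
      omega
    set d := Module.finrank ℂ (Representation.invariants (ρ.comp Z.subtype))
    set N := Nat.card Z - 1
    have hN : (N : ℂ) ≠ 0 := by
      have : N ≠ 0 := by omega
      exact_mod_cast this
    let q : ℚ := ((Nat.card Z : ℚ) * d - n) / N
    have hq : χ g = (q : ℂ) := by
      simp only [q]
      push_cast
      rw [eq_div_iff hN, ← h1, OneMemClass.coe_one, h3]
      ring
    rw [hq] at hint ⊢
    have hq' : IsIntegral ℤ q := (isIntegral_algebraMap_iff (algebraMap ℚ ℂ).injective).1 hint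
    obtain ⟨a, ha⟩ := IsIntegrallyClosed.isIntegral_iff.1 hq'
    exact ⟨a, by rw [← ha]; simp⟩
  · exact (hχ.eq_of_isConj (hconj z z.2 fun h => (Finset.mem_erase.1 hz).1 (Subtype.ext h))).symm

/-- If `g` has a small centralizer and is conjugate to all nontrivial elements of the cyclic group
it generates, some nonlinear irreducible character is the only one not vanishing at `g`. -/
theorem exists_isolated_of_card_centralizer_le [Finite G] {g : G} (hg : g ≠ 1)
    (hgc : g ∈ commutator G)
    (hconj : ∀ z ∈ Subgroup.zpowers g, z ≠ 1 → IsConj g z)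
    (hcard : Nat.card (Subgroup.centralizer {g}) ≤ Nat.card (G ⧸ commutator G) + 1) :
    ∃ χ : G → ℂ, IsNonlinearIrrChar χ ∧ χ g ≠ 0 ∧
      ∀ ψ : G → ℂ, IsNonlinearIrrChar ψ → ψ ≠ χ → ψ g = 0 := by
  classical
  have hcardne : (Nat.card (G ⧸ commutator G) : ℂ) ≠ 0 := by exact_mod_cast Nat.card_pos.ne'
  -- Otherwise orthogonality of the columns of g and 1 would read |G:G'| = 0.
  have hex : ∃ χ : G → ℂ, IsNonlinearIrrChar χ ∧ χ g ≠ 0 := by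
    by_contra! hno
    have h1 := card_add_sum_nonlinear_irrChars g 1
    rw [Finset.sum_eq_zero, if_pos (by simpa using hgc), if_neg (by rwa [isConj_one_right]),
      add_zero] at h1
    · exact hcardne h1
    · intro ψ hψ
      rw [hno ψ (mem_filter_nonlinear_irrChars.1 hψ), zero_mul]
  obtain ⟨χ, hχ, h0⟩ := hex
  refine ⟨χ, hχ, h0, fun ψ hψ hne => ?_⟩
  by_contra hψ0
  have hval : ∀ φ : G → ℂ, ∃ a : ℤ, IsIrrChar φ → φ g = a := fun φ => by
    by_cases hφ : IsIrrChar φ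
    · obtain ⟨a, ha⟩ := hφ.exists_int_eq hg hconj
      exact ⟨a, fun _ => ha⟩
    · exact ⟨0, fun h => absurd h hφ⟩
  choose a ha using hval
  have hinv : ∀ φ : G → ℂ, IsIrrChar φ → φ g⁻¹ = a φ := fun φ hφ => by
    rw [← ha φ hφ, hφ.eq_of_isConj (hconj g⁻¹ (inv_mem (Subgroup.mem_zpowers g)) (inv_ne_one.2 hg))]
  have h1 := card_add_sum_nonlinear_irrChars g g
  rw [if_pos (by simp), if_pos (IsConj.refl g),
    Finset.sum_congr rfl (g := fun φ => ((a φ ^ 2 : ℤ) : ℂ)) (fun φ hφ => ?_)] at h1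
  -- Since g ~ g⁻¹, column g paired with itself is a sum of integer squares; two nonzero squares
  -- would exceed the available 1.
  · have h2 : (Nat.card (G ⧸ commutator G) : ℤ) +
        ∑ φ ∈ irrChars G with φ 1 ≠ 1, a φ ^ 2 = Nat.card (Subgroup.centralizer {g}) := by
      exact_mod_cast h1
    have h3 : ∑ φ ∈ ({χ, ψ} : Finset (G → ℂ)), a φ ^ 2 ≤
        ∑ φ ∈ irrChars G with φ 1 ≠ 1, a φ ^ 2 := by
      refine Finset.sum_le_sum_of_subset_of_nonneg ?_ fun _ _ _ => sq_nonneg _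
      intro φ hφ
      rw [Finset.mem_insert, Finset.mem_singleton] at hφ
      rcases hφ with rfl | rfl
      · exact mem_filter_nonlinear_irrChars.2 hχ
      · exact mem_filter_nonlinear_irrChars.2 hψ
    rw [Finset.sum_pair hne.symm] at h3
    have h4 : ∀ φ : G → ℂ, IsNonlinearIrrChar φ → φ g ≠ 0 → 0 < a φ ^ 2 := by
      intro φ hφ hφ0
      rw [ha φ hφ.1] at hφ0
      have : a φ ≠ 0 := by exact_mod_cast hφ0
      positivity
    have h5 := h4 χ hχ h0
    have h6 := h4 ψ hψ hψ0
    have h7 : (Nat.card (Subgroup.centralizer {g}) : ℤ) ≤ Nat.card (G ⧸ commutator G) + 1 := by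
      exact_mod_cast hcard
    linarith
  · have hφ' := (mem_filter_nonlinear_irrChars.1 hφ).1
    rw [hinv φ hφ', ha φ hφ']
    push_cast; ring

end LinearCharacters

/-! ### Fixed-point-free actions of elementary abelian groups. -/

section FixedPointFreeActions

/-- The norm of an element under a fixed-point-free automorphism of order dividing `p` is trivial. -/
theorem prod_pow_smul_eq_one {H A : Type*} [Group H] [CommGroup A] [MulDistribMulAction H A]
    {p : ℕ} {h : H} (hp : h ^ p = 1) (hfix : ∀ a : A, h • a = a → a = 1) (a : A) :
    ∏ i ∈ Finset.range p, h ^ i • a = 1 := by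
  apply hfix
  rw [Finset.smul_prod']
  -- The product over `range (p + 1)` is split off at either end; the two end factors agree because
  -- `h ^ p = 1`.
  have h1 := Finset.prod_range_succ (fun i => h ^ i • a) p
  rw [Finset.prod_range_succ', pow_zero, hp] at h1
  rw [← mul_right_cancel h1]
  exact Finset.prod_congr rfl fun i _ => by rw [smul_smul, ← pow_succ']

/-- The norms of `a` under h·kʲ, j < p, are all 1. In their product the terms with exponent i = 0
give aᵖ; those with a fixed i ≠ 0 give hⁱ applied to the norm of `a` under kⁱ, which is 1. -/
theorem pow_eq_one_of_fixedPointFree {H A : Type*} [Group H] [CommGroup A] [MulDistribMulAction H A]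
    {p : ℕ} (hp : p.Prime) (hcomm : ∀ x y : H, x * y = y * x) (hexp : ∀ x : H, x ^ p = 1)
    (hfix : ∀ h : H, h ≠ 1 → ∀ a : A, h • a = a → a = 1) {h k : H} (hk : k ≠ 1)
    (hh : h ∉ Subgroup.zpowers k) (a : A) : a ^ p = 1 := by
  have h1 : ∏ j ∈ Finset.range p, ∏ i ∈ Finset.range p, (h * k ^ j) ^ i • a = 1 := by
    refine Finset.prod_eq_one fun j _ => prod_pow_smul_eq_one (hexp _) (hfix _ fun h0 => hh ?_) a
    rw [eq_inv_of_mul_eq_one_left h0]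
    exact inv_mem (pow_mem (Subgroup.mem_zpowers k) j)
  rw [Finset.prod_comm, Finset.prod_eq_single_of_mem 0 (Finset.mem_range.2 hp.pos)] at h1
  · simpa using h1
  · intro i hi hi0
    have hki : k ^ i ≠ 1 := by
      rw [Ne, ← orderOf_dvd_iff_pow_eq_one, @orderOf_eq_prime _ _ _ _ ⟨hp⟩ (hexp k) hk]
      exact fun hd => absurd (Nat.le_of_dvd (Nat.pos_of_ne_zero hi0) hd)
        (not_le.2 (Finset.mem_range.1 hi))
    have h2 : ∀ j, (h * k ^ j) ^ i • a = h ^ i • (k ^ i) ^ j • a := by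
      intro j
      rw [(show Commute h (k ^ j) from hcomm _ _).mul_pow, smul_smul, ← pow_mul, ← pow_mul,
        mul_comm]
    simp only [h2]
    rw [← Finset.smul_prod', prod_pow_smul_eq_one (hexp _) (hfix _ hki), smul_one]

/-- An elementary abelian `p`-group acting fixed-point-freely on a nontrivial `p'`-group is cyclic. -/
theorem mem_zpowers_of_fixedPointFree {H K : Type*} [Group H] [Finite H] [Group K] [Finite K]
    [Nontrivial K] [MulDistribMulAction H K]
    {p : ℕ} (hp : p.Prime) (hcomm : ∀ x y : H, x * y = y * x) (hexp : ∀ x : H, x ^ p = 1)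
    (hfix : ∀ h : H, h ≠ 1 → ∀ a : K, h • a = a → a = 1) (hpK : ¬ p ∣ Nat.card K)
    {k : H} (hk : k ≠ 1) (h : H) : h ∈ Subgroup.zpowers k := by
  by_contra hh
  have : Fact p.Prime := ⟨hp⟩
  have hpg : IsPGroup p H := fun x => ⟨1, by rw [pow_one]; exact hexp x⟩
  obtain ⟨q, hq, hqK⟩ := Nat.exists_prime_and_dvd (Finite.one_lt_card (α := K)).ne'
  have : Fact q.Prime := ⟨hq⟩
  -- The number of Sylow q-subgroups divides |K|, so it is prime to p and the p-group H fixes one of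
  -- them.
  obtain ⟨Q, hQ⟩ := hpg.nonempty_fixed_point_of_prime_not_dvd_card (Sylow q K) fun hd =>
    hpK (hd.trans ((default : Sylow q K).card_dvd_index.trans (Subgroup.index_dvd_card _)))
  have hQmem : ∀ (x : H) {a : K}, a ∈ Q → x • a ∈ Q := by
    intro x a ha
    have h1 : x • Q = Q := hQ x
    rw [← h1]
    exact Subgroup.smul_mem_pointwise_smul a x (Q : Subgroup K) ha
  -- The centre of `Q`, viewed inside `K`: a nontrivial abelian H-invariant subgroup. The abelian
  -- case makes its exponent divide p, contradicting p ∤ |K|.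
  let A : Subgroup K := (Q : Subgroup K) ⊓ Subgroup.centralizer (Q : Set K)
  let _ : CommGroup A :=
    { (inferInstance : Group A) with
      mul_comm := fun a b => Subtype.ext (Subgroup.mem_centralizer_iff.1 b.2.2 a a.2.1) }
  have hAmem : ∀ (x : H) (a : A), x • (a : K) ∈ A := by
    intro x a
    refine ⟨hQmem x a.2.1, Subgroup.mem_centralizer_iff.2 fun b hb => ?_⟩
    have h1 := Subgroup.mem_centralizer_iff.1 a.2.2 (x⁻¹ • b) (hQmem x⁻¹ hb)
    have h2 := congrArg (x • ·) h1
    simpa [smul_mul'] using h2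
  let _ : MulDistribMulAction H A :=
    { smul := fun x a => ⟨x • (a : K), hAmem x a⟩
      one_smul := fun a => Subtype.ext (one_smul H (a : K))
      mul_smul := fun x y a => Subtype.ext (mul_smul x y (a : K))
      smul_mul := fun x a b => Subtype.ext (smul_mul' x (a : K) b)
      smul_one := fun x => Subtype.ext (smul_one x) }
  have hAfix : ∀ x : H, x ≠ 1 → ∀ a : A, x • a = a → a = 1 := fun x hx a ha =>
    Subtype.ext (hfix x hx a (congrArg Subtype.val ha))
  have hQnt : Nontrivial Q := (Subgroup.nontrivial_iff_ne_bot _).2 (Q.ne_bot_of_dvd_card hqK)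
  have := Q.2.center_nontrivial
  obtain ⟨z, hz⟩ := exists_ne (1 : Subgroup.center Q)
  have hzA : ((z : Q) : K) ∈ A := ⟨z.1.2, Subgroup.mem_centralizer_iff.2 fun b hb =>
    congrArg Subtype.val (Subgroup.mem_center_iff.1 z.2 ⟨b, hb⟩)⟩
  have h1 := pow_eq_one_of_fixedPointFree (A := A) hp hcomm hexp hAfix hk hh ⟨_, hzA⟩
  have h2 : ((z : Q) : K) ^ p = 1 := congrArg Subtype.val h1
  have h3 : orderOf ((z : Q) : K) = p := orderOf_eq_prime h2 fun h0 =>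
    hz (Subtype.ext (Subtype.ext h0))
  exact hpK (h3 ▸ orderOf_dvd_natCard _)

end FixedPointFreeActions

/-! ### Centralizers in Frobenius groups. -/

section FrobeniusGroups

variable {G : Type*} [Group G] [Finite G]

/-- In a Frobenius group, the centralizer of a nontrivial element of the kernel lies in the
kernel. -/
theorem IsFrobeniusWithKernel.mem_of_commute {N : Subgroup G} (h : IsFrobeniusWithKernel N)
    {n x : G} (hn : n ∈ N) (hn1 : n ≠ 1) (hx : x * n = n * x) : x ∈ N := by
  obtain ⟨hN, -, H, -, hc, hfix⟩ := h
  obtain ⟨⟨a, b⟩, hab⟩ := hc.2 x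
  simp only at hab
  by_cases hb : (b : G) = 1
  · rw [← hab, hb, mul_one]; exact a.2
  exfalso
  -- For b ≠ 1 in the complement, c ↦ [c, b] is injective on N, hence surjective. So `x = a * b` is
  -- a conjugate c b c⁻¹, and b centralizes c⁻¹nc.
  let f : N → N := fun c => ⟨c * (b * c⁻¹ * b⁻¹), mul_mem c.2 (hN.conj_mem _ (inv_mem c.2) _)⟩
  have hf : Function.Injective f := by
    intro c d hcd
    have h1 : (c : G) * (b * c⁻¹ * b⁻¹) = d * (b * d⁻¹ * b⁻¹) := congrArg Subtype.val hcd
    have h2 := hfix b b.2 hb ((d : G)⁻¹ * c) (mul_mem (inv_mem d.2) c.2) (by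
      have h3 : (c : G) * b * (c : G)⁻¹ = d * b * (d : G)⁻¹ := by
        have := congrArg (· * (b : G)) h1
        simpa [mul_assoc] using this
      have h4 : (d : G)⁻¹ * (c * b * (c : G)⁻¹) * c = (d : G)⁻¹ * (d * b * (d : G)⁻¹) * c := by
        rw [h3]
      simpa [mul_assoc] using h4.symm)
    exact Subtype.ext (inv_mul_eq_one.1 h2).symm
  obtain ⟨c, hc⟩ := Finite.surjective_of_injective hf a
  have h1 : (c : G) * (b * (c : G)⁻¹ * (b : G)⁻¹) = a := congrArg Subtype.val hc
  have h2 : x = c * b * (c : G)⁻¹ := by rw [← hab, ← h1]; group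
  have h3 := hfix b b.2 hb ((c : G)⁻¹ * n * c) (by
    simpa using hN.conj_mem n hn (c : G)⁻¹) (by
      rw [h2] at hx
      have h4 := congrArg (fun t => (c : G)⁻¹ * t * c) hx
      simpa [mul_assoc] using h4)
  apply hn1
  have h4 := congrArg (fun t => (c : G) * t * (c : G)⁻¹) h3
  simpa [mul_assoc] using h4

end FrobeniusGroups

/-! ### Conjugacy classes and complements for a pair K ≤ L. -/

section TwoFrobenius

variable {G : Type*} [Group G]

theorem card_subgroupOf_of_le {K L : Subgroup G} (h : K ≤ L) :
    Nat.card (K.subgroupOf L) = Nat.card K :=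
  Nat.card_congr (Subgroup.subgroupOfEquivOfLe h).toEquiv

theorem card_mul_relIndex_of_le {K L : Subgroup G} (h : K ≤ L) :
    Nat.card K * K.relIndex L = Nat.card L := by
  rw [← card_subgroupOf_of_le h]
  exact Subgroup.card_mul_index _

theorem card_map_mk' (K L : Subgroup G) [K.Normal] :
    Nat.card (L.map (QuotientGroup.mk' K)) = K.relIndex L := by
  rw [← Subgroup.relIndex_ker, QuotientGroup.ker_mk']

theorem card_setOf_mem_notMem [Finite G] {K L : Subgroup G} (h : K ≤ L) :
    Nat.card {z // z ∈ L ∧ z ∉ K} + Nat.card K = Nat.card L := by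
  have h1 := Set.ncard_sdiff_add_ncard_of_subset (s := (K : Set G)) (t := (L : Set G)) h
  exact h1

/-- If `K` is the kernel of a character isolated at a noncentral element, the complement of `K` in
the commutator subgroup is a conjugacy class. -/
theorem IsolatedCharWithKernel.le_and_isConj_iff [Finite G] {K : Subgroup G}
    (h : IsolatedCharWithKernel G K) :
    K ≤ commutator G ∧
      ∃ g : G, ∀ x, IsConj g x ↔ x ∈ commutator G ∧ x ∉ K := by
  obtain ⟨g, χ, hgZ, hχ, h0, hiso, hK⟩ := h
  have hg1 : g ≠ 1 := fun h => hgZ (h ▸ one_mem _)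
  obtain ⟨hgc, hker⟩ := isolated_mem_commutator_and_ker hg1 hχ h0 hiso
  refine ⟨fun x hx => ((hker x).1 ((hK x).1 hx)).1, g, fun x => ?_⟩
  -- The kernel is described through x⁻¹; since K is closed under inverses, x may replace it.
  have h1 : x ∈ K ↔ x ∈ commutator G ∧ ¬ IsConj x g := by
    rw [← inv_mem_iff, hK, hker, inv_inv, inv_mem_iff]
  rw [h1, isConj_comm]
  constructor
  · intro hx
    obtain ⟨c, rfl⟩ := isConj_iff.1 hx.symm
    exact ⟨(inferInstance : (commutator G).Normal).conj_mem g hgc c, fun h => h.2 hx⟩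
  · rintro ⟨hx, hn⟩
    by_contra hc
    exact hn ⟨hx, hc⟩

/-- A normal `p'`-subgroup `K ≤ L` of index `p ^ m` such that no element of `L` outside `K`
commutes with a nontrivial element of `K` is a Frobenius kernel of `L`; when `L / K` is elementary
abelian, `m = 1`. -/
theorem isFrobeniusWithKernel_subgroupOf [Finite G] {K L : Subgroup G} [K.Normal] (hKL : K ≤ L)
    {p m : ℕ} (hp : p.Prime) (hm : 1 ≤ m) (hK : K ≠ ⊥) (hpK : ¬ p ∣ Nat.card K)
    (hindex : K.relIndex L = p ^ m)
    (hel : IsElementaryAbelian p (L.map (QuotientGroup.mk' K)))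
    (hfix : ∀ x ∈ L, x ∉ K → ∀ k ∈ K, x * k = k * x → k = 1) :
    IsFrobeniusWithKernel (K.subgroupOf L) ∧ m = 1 := by
  have hcop : (Nat.card (K.subgroupOf L)).Coprime (K.subgroupOf L).index := by
    rw [card_subgroupOf_of_le hKL]
    change (Nat.card K).Coprime (K.relIndex L)
    rw [hindex]
    exact Nat.Coprime.pow_right _ ((Nat.Prime.coprime_iff_not_dvd hp).2 hpK).symm
  -- Schur–Zassenhaus. The complement embeds in L/K, which makes it elementary abelian.
  obtain ⟨H, hH⟩ := Subgroup.exists_right_complement'_of_coprime hcop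
  have hHcard : Nat.card H = p ^ m := by
    rw [← hindex]; exact hH.symm.index_eq_card.symm
  have hpm : 1 < p ^ m := Nat.one_lt_pow (by omega) hp.one_lt
  have hHK : ∀ h ∈ H, (h : G) ∈ K → h = 1 := fun h hh hk =>
    Subgroup.disjoint_def.1 hH.disjoint (Subgroup.mem_subgroupOf.2 hk) hh
  have hHbot : H ≠ ⊥ := by
    rintro rfl
    rw [Subgroup.card_bot] at hHcard
    omega
  have hHfix : ∀ h ∈ H, h ≠ 1 → ∀ n ∈ K.subgroupOf L, h * n = n * h → n = 1 :=
    fun h hh h1 n hn hc => Subtype.ext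
      (hfix h h.2 (fun hk => h1 (hHK h hh hk)) n hn (congrArg Subtype.val hc))
  have hKbot : K.subgroupOf L ≠ ⊥ := by
    rw [Ne, Subgroup.subgroupOf_eq_bot, disjoint_comm]
    exact fun hd => hK (hd.symm.eq_bot_of_le hKL)
  refine ⟨⟨inferInstance, hKbot, H, hHbot, hH, hHfix⟩, ?_⟩
  have hmem : ∀ h : L, QuotientGroup.mk' K (h : G) ∈ L.map (QuotientGroup.mk' K) := fun h =>
    Subgroup.mem_map_of_mem _ h.2
  have hcomm : ∀ x y : H, x * y = y * x := by
    intro x y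
    have h1 : QuotientGroup.mk' K ((x : L) * (y : L) : G) = QuotientGroup.mk' K ((y : L) * (x : L) : G) := by
      have := congrArg Subtype.val (hel.1 ⟨_, hmem x⟩ ⟨_, hmem y⟩)
      simpa using this
    have h2 := (QuotientGroup.eq (s := K)).1 h1
    have h3 := hHK _ ((x * y)⁻¹ * (y * x)).2 h2
    exact inv_mul_eq_one.1 (Subtype.ext h3)
  have hexp : ∀ x : H, x ^ p = 1 := by
    intro x
    have h1 : QuotientGroup.mk' K (((x : L) : G) ^ p) = 1 := by
      have := congrArg Subtype.val (hel.2 ⟨_, hmem x⟩)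
      simpa using this
    exact Subtype.ext (hHK _ (x ^ p).2 ((QuotientGroup.eq_one_iff _).1 h1))
  let _ : MulDistribMulAction H K :=
    MulDistribMulAction.compHom K ((MulAut.conjNormal (H := K)).comp (L.subtype.comp H.subtype))
  have hact : ∀ (h : H) (a : K), ((h • a : K) : G) = (h : L) * a * ((h : L) : G)⁻¹ :=
    fun h a => MulAut.conjNormal_apply _ _
  have : Nontrivial K := (Subgroup.nontrivial_iff_ne_bot K).2 hK
  have : Nontrivial H := (Subgroup.nontrivial_iff_ne_bot H).2 hHbot
  obtain ⟨k, hk⟩ := exists_ne (1 : H)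
  have hcyc := mem_zpowers_of_fixedPointFree (H := H) (K := K) hp hcomm hexp (by
    intro h h1 a ha
    refine Subtype.ext (hfix (h : L) (h : L).2 (fun hk => h1 (Subtype.ext (hHK _ h.2 hk))) a a.2 ?_)
    have := congrArg Subtype.val ha
    rw [hact, mul_inv_eq_iff_eq_mul] at this
    exact this) hpK hk
  have hcard : p ^ m = p ^ 1 := by
    have : Fact p.Prime := ⟨hp⟩
    rw [← hHcard, pow_one, ← orderOf_eq_prime (hexp k) hk, ← Nat.card_zpowers,
      (Subgroup.eq_top_iff' _).2 hcyc, Subgroup.card_top]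
  exact Nat.pow_right_injective hp.two_le hcard

/-- If some element of `L` outside `K` has a centralizer as small as possible, the complement of `K` in `L` is a conjugacy class. -/
theorem isConj_iff_of_card_centralizer_le [Finite G] {K L : Subgroup G} [hKn : K.Normal] [hLn : L.Normal]
    (hKL : K ≤ L) {p : ℕ} (hp : 1 < p) (hindex : K.relIndex L = p) (hLindex : L.index = p - 1)
    {g : G} (hgL : g ∈ L) (hgK : g ∉ K) (hcard : Nat.card (Subgroup.centralizer {g}) ≤ p) (x : G) :
    IsConj g x ↔ x ∈ L ∧ x ∉ K := by
  have hsub : {z | IsConj g z} ⊆ {z | z ∈ L ∧ z ∉ K} := by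
    intro z hz
    obtain ⟨c, rfl⟩ := isConj_iff.1 hz
    exact ⟨hLn.conj_mem g hgL c, fun h => hgK (by
      simpa [mul_assoc] using hKn.conj_mem _ h c⁻¹)⟩
  have h1 := card_conj_mul_card_centralizer g
  have h2 := card_setOf_mem_notMem hKL
  have h3 := card_mul_relIndex_of_le hKL
  have h4 := L.card_mul_index
  rw [hindex] at h3
  rw [hLindex, ← h3, ← h1] at h4
  -- The class has at least |G|/p = |K|(p - 1) elements, the size of L \ K, which contains it.
  have h5 : Nat.card {z // z ∈ L ∧ z ∉ K} ≤ Nat.card {z // IsConj g z} := by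
    have h6 : Nat.card {z // z ∈ L ∧ z ∉ K} = Nat.card K * (p - 1) := by
      rw [← h3] at h2
      obtain ⟨r, rfl⟩ : ∃ r, p = r + 1 := ⟨p - 1, by omega⟩
      rw [Nat.add_sub_cancel]
      linarith
    rw [h6]
    have h7 : Nat.card K * (p - 1) * p ≤ Nat.card {z // IsConj g z} * p := by
      calc _ = Nat.card {z // IsConj g z} * Nat.card (Subgroup.centralizer {g}) := by
            rw [← h4]; ring
        _ ≤ _ := Nat.mul_le_mul_left _ hcard
    exact Nat.le_of_mul_le_mul_right h7 (by omega)
  have h8 := Set.eq_of_subset_of_ncard_le hsub h5 (Set.toFinite _)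
  exact Set.ext_iff.1 h8 x

end TwoFrobenius

/-! ### The two directions of the theorem. -/

theorem mainTheorem12 {G : Type*} [Group G] [Finite G] (K : Subgroup G) [K.Normal]
    (p : ℕ) (hp : p.Prime) :
    (∀ m : ℕ, 1 ≤ m →
      IsolatedCharWithKernel G K →
      IsFrobeniusWithKernel ((commutator G).map (QuotientGroup.mk' K)) →
      IsElementaryAbelian p ((commutator G).map (QuotientGroup.mk' K)) →
      Nat.card ((commutator G).map (QuotientGroup.mk' K)) = p ^ m →
      IsCyclic (G ⧸ commutator G) →
      Nat.card (G ⧸ commutator G) = p ^ m - 1 →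
      K ≠ ⊥ →
      ¬ p ∣ Nat.card K →
      IsTwoFrobenius K (commutator G) ∧ m = 1) ∧
    (IsTwoFrobenius K (commutator G) →
      K.relIndex (commutator G) = p →
      IsCyclic (G ⧸ commutator G) →
      Nat.card (G ⧸ commutator G) = p - 1 →
      IsolatedCharWithKernel G K) := by
  constructor
  · intro m hm hiso hfrob hel hcard _ hquot hK hpK
    obtain ⟨hKL, g, hg⟩ := hiso.le_and_isConj_iff
    rw [card_map_mk'] at hcard
    have hfix : ∀ x ∈ commutator G, x ∉ K → ∀ k ∈ K, x * k = k * x → k = 1 := by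
      intro x hxL hxK k hk hxk
      have hconj : ∀ z, IsConj x z ↔ z ∈ commutator G ∧ z ∉ K := fun z => by
        have hgx := (hg x).2 ⟨hxL, hxK⟩
        rw [← hg z]
        exact ⟨fun h => hgx.trans h, fun h => hgx.symm.trans h⟩
      have h1 := card_conj_mul_card_centralizer x
      rw [Nat.card_congr (Equiv.subtypeEquivRight hconj)] at h1
      have h2 := card_setOf_mem_notMem hKL
      have h3 := card_mul_relIndex_of_le hKL
      have h4 : Nat.card (commutator G) * (p ^ m - 1) = Nat.card G := by
        rw [← hquot]; exact (commutator G).card_mul_index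
      rw [hcard] at h3
      have hKpos : 0 < Nat.card K := Nat.card_pos
      have hpm : 1 < p ^ m := Nat.one_lt_pow (by omega) hp.one_lt
      -- The class of x is G' \ K, of size |K|(p^m - 1), while |G| = |K| p^m (p^m - 1).
      have h5 : Nat.card (Subgroup.centralizer {x}) = p ^ m := by
        obtain ⟨r, hr⟩ : ∃ r, p ^ m = r + 1 := ⟨p ^ m - 1, by omega⟩
        rw [← h3, hr] at h2 h4
        rw [Nat.add_sub_cancel] at h4
        have h6 : Nat.card {z // z ∈ commutator G ∧ z ∉ K} = Nat.card K * r := by linarith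
        rw [h6, ← h4] at h1
        have h7 : 0 < Nat.card K * r := Nat.mul_pos hKpos (by omega)
        rw [hr]
        apply Nat.eq_of_mul_eq_mul_left h7
        rw [h1]; ring
      have hkc : k ∈ Subgroup.centralizer {x} := Subgroup.mem_centralizer_singleton_iff.2 hxk.symm
      have hd1 : orderOf k ∣ p ^ m := h5 ▸ Subgroup.orderOf_dvd_natCard _ hkc
      have hd2 : orderOf k ∣ Nat.card K := Subgroup.orderOf_dvd_natCard _ hk
      have hcop : (p ^ m).Coprime (Nat.card K) :=
        Nat.Coprime.pow_left _ ((Nat.Prime.coprime_iff_not_dvd hp).2 hpK)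
      exact orderOf_eq_one_iff.1 (Nat.eq_one_of_dvd_coprimes hcop hd1 hd2)
    obtain ⟨h1, h2⟩ := isFrobeniusWithKernel_subgroupOf hKL hp hm hK hpK hcard hel hfix
    exact ⟨⟨inferInstance, hKL, h1, hfrob⟩, h2⟩
  · rintro ⟨-, hKL, ⟨hKn, hKbot, C, hCbot, hC, hCfix⟩, hfrob⟩ hindex _ hquot
    have hCcard : Nat.card C = p := by rw [← hindex]; exact hC.symm.index_eq_card.symm
    have hCnt : Nontrivial C := (Subgroup.nontrivial_iff_ne_bot C).2 hCbot
    obtain ⟨⟨⟨g, hgL⟩, hgC⟩, hg1⟩ := exists_ne (1 : C)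
    have hgL1 : (⟨g, hgL⟩ : commutator G) ≠ 1 := fun h => hg1 (Subtype.ext h)
    have hgne : g ≠ 1 := fun h => hgL1 (Subtype.ext h)
    have hCK : ∀ y : commutator G, y ∈ C → (y : G) ∈ K → y = 1 := fun y hy hk =>
      Subgroup.disjoint_def.1 hC.disjoint (Subgroup.mem_subgroupOf.2 hk) hy
    have hgK : g ∉ K := fun h => hgL1 (hCK _ hgC h)
    have hgfix : ∀ k ∈ K, k * g = g * k → k = 1 := fun k hk hkg =>
      congrArg Subtype.val (hCfix _ hgC hgL1 ⟨k, hKL hk⟩ (Subgroup.mem_subgroupOf.2 hk)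
        (Subtype.ext hkg.symm))
    -- In the Frobenius group G/K, whatever centralizes the nontrivial image of g lies in the kernel
    -- G'/K.
    have hcent : Subgroup.centralizer {g} ≤ commutator G := by
      intro x hx
      have hx' := Subgroup.mem_centralizer_singleton_iff.1 hx
      have h1 := hfrob.mem_of_commute (n := QuotientGroup.mk' K g) (x := QuotientGroup.mk' K x)
        (Subgroup.mem_map_of_mem _ hgL) (fun h => hgK ((QuotientGroup.eq_one_iff _).1 h))
        (by rw [← map_mul, ← map_mul, hx'])
      obtain ⟨y, hy, hyx⟩ := h1
      have h2 : y⁻¹ * x ∈ K := (QuotientGroup.eq (s := K)).1 hyx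
      have := mul_mem hy (hKL h2)
      rwa [mul_inv_cancel_left] at this
    -- C(g) embeds in G'/K because it meets K trivially.
    have hcardcent : Nat.card (Subgroup.centralizer {g}) ≤ p := by
      rw [← hindex, ← card_map_mk']
      refine Nat.card_le_card_of_injective (fun x => ⟨QuotientGroup.mk' K x,
        Subgroup.mem_map_of_mem _ (hcent x.2)⟩) fun x y hxy => ?_
      have h1 : (x : G)⁻¹ * y ∈ K := (QuotientGroup.eq (s := K)).1 (congrArg Subtype.val hxy)
      exact Subtype.ext (inv_mul_eq_one.1 (hgfix _ h1
        (Subgroup.mem_centralizer_singleton_iff.1 (x⁻¹ * y).2)))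
    have hconj := isConj_iff_of_card_centralizer_le hKL hp.one_lt hindex hquot hgL hgK hcardcent
    -- Nontrivial powers of g stay in the complement C, hence outside K, hence in the class of g.
    obtain ⟨χ, hχ, h0, hiso⟩ := exists_isolated_of_card_centralizer_le hgne hgL (by
        intro z hz hz1
        obtain ⟨i, rfl⟩ := Subgroup.mem_zpowers_iff.1 hz
        refine (hconj _).2 ⟨zpow_mem hgL i, fun hk => hz1 ?_⟩
        exact congrArg Subtype.val (hCK (⟨g, hgL⟩ ^ i) (zpow_mem hgC i) hk)) (by
        rw [hquot]; have := hp.one_lt; omega)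
    refine ⟨g, χ, fun hZ => hKbot ?_, hχ, h0, hiso, fun x => ?_⟩
    · refine (Subgroup.eq_bot_iff_forall _).2 fun k hk => Subtype.ext ?_
      exact hgfix k hk (Subgroup.mem_center_iff.1 hZ k)
    · rw [(isolated_mem_commutator_and_ker hgne hχ h0 hiso).2, isConj_comm, hconj, inv_mem_iff,
        inv_mem_iff]
      exact ⟨fun h => ⟨hKL h, fun h' => h'.2 h⟩, fun h => by
        by_contra hx
        exact h.2 ⟨h.1, hx⟩⟩
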